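/- Let $d\ge 0$ and let $P\subset\mathbb{R}^d$ be a lattice $d$-polytope, i.e. the convex hull of finitely many points of $\mathbb{Z}^d$ with $\dim P=d$. For $m\ge 1$ let $L_P(m)=|mP\cap\mathbb{Z}^d|$. The $h^\ast$-polynomial $h^\ast_P(z)$ of $P$ is the polynomial determined by $$1+\sum_{m\ge 1}L_P(m)z^m=\frac{h^\ast_P(z)}{(1-z)^{d+1}}.$$ Let $\mathcal{T}$ be a triangulation of $P$ with vertices in $P\cap\mathbb{Z}^d$, and suppose that $\mathcal{T}$ is * regular: there is a weight function $\omega:P\cap\mathbb{Z}^d\to\mathbb{R}$ such that the simplices of $\mathcal{T}$ are exactly the images, under the projection $\mathbb{R}^d\times\mathbb{R}\to\mathbb{R}^d$, of the lower faces of $\operatorname{conv}\{(\boldsymbol{a},\omega(\boldsymbol{a})):\boldsymbol{a}\in P\cap\mathbb{Z}^d\}$ (the faces having an outer normal vector with negative last coordinate); and * unimodular: every $d$-simplex of $\mathcal{T}$ has normalized volume $1$, i.e. Euclidean volume $1/d!$. Let $f_k(\mathcal{T})$ be the number of $k$-dimensional simplices of $\mathcal{T}$ for $k \ge 0$, let $f_{-1}(\mathcal{T})=1$,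 and let $$h_{\mathcal{T}}(z)=\sum_{k=-1}^{d}f_k(\mathcal{T})\,z^{k+1}(1-z)^{d-k}$$ be the $h$-polynomial of $\mathcal{T}$. Then $h^\ast_P(z)=h_{\mathcal{T}}(z)$. -/

import Mathlib

open scoped Pointwise ENNReal Nat

noncomputable section

namespace EhrhartTheory

/-- The integer lattice `ℤ^d` inside `ℝ^d`. -/
def lattice (d : ℕ) : Set (Fin d → ℝ) :=
  Set.range fun (z : Fin d → ℤ) (i : Fin d) => (z i : ℝ)

/-- `P` is a lattice `d`-polytope in `ℝ^d`: the convex hull of finitely many lattice points,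
of full dimension `d`. -/
structure IsLatticeDPolytope {d : ℕ} (P : Set (Fin d → ℝ)) : Prop where
  exists_eq_convexHull : ∃ S : Set (Fin d → ℝ), S.Finite ∧ S ⊆ lattice d ∧ P = convexHull ℝ S
  affineSpan_eq_top : affineSpan ℝ P = ⊤

/-! ### Ehrhart series and `h*`-polynomial -/

/-- `L_P(m)`, the number of lattice points in the dilate `mP`. -/
def latticePointCount {d : ℕ} (P : Set (Fin d → ℝ)) (m : ℕ) : ℕ :=
  (((m : ℝ) • P) ∩ lattice d).ncard

/-- The Ehrhart series `1 + ∑_{m ≥ 1} L_P(m) z^m`. -/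
def ehrhartSeries {d : ℕ} (P : Set (Fin d → ℝ)) : PowerSeries ℤ :=
  PowerSeries.mk fun m => if m = 0 then 1 else (latticePointCount P m : ℤ)

/-- `h` is the numerator of the Ehrhart series: `Ehr_P(z) = h(z) / (1 - z)^(d+1)`. -/
def IsHStarPolynomial {d : ℕ} (P : Set (Fin d → ℝ)) (h : Polynomial ℤ) : Prop :=
  ehrhartSeries P * (1 - PowerSeries.X) ^ (d + 1) = (h : PowerSeries ℤ)

/-- There is at most one numerator polynomial. -/
theorem IsHStarPolynomial.unique {d : ℕ} {P : Set (Fin d → ℝ)} {h h' : Polynomial ℤ}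
    (hh : IsHStarPolynomial P h) (hh' : IsHStarPolynomial P h') : h = h' :=
  Polynomial.coe_injective ℤ (Eq.trans (Eq.symm hh) hh')

open Classical in
/-- The `h*`-polynomial of `P`: the numerator of the Ehrhart series
(with the value `0` if there were no such polynomial). -/
def hStarPolynomial {d : ℕ} (P : Set (Fin d → ℝ)) : Polynomial ℤ :=
  if h : ∃ p : Polynomial ℤ, IsHStarPolynomial P p then h.choose else 0

/-! ### Triangulations -/

/-- The simplicial complex `T` is a triangulation of `P` whose vertices are lattice points
of `P`. The faces of `T` are the vertex sets of its nonempty simplices. -/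
structure IsLatticeTriangulation {d : ℕ} (P : Set (Fin d → ℝ))
    (T : Geometry.SimplicialComplex ℝ (Fin d → ℝ)) : Prop where
  finite_faces : T.faces.Finite
  vertices_subset : T.vertices ⊆ P ∩ lattice d
  space_eq : T.space = P

/-- The polytope `conv {(a, ω(a)) : a ∈ P ∩ ℤ^d}` in `ℝ^d × ℝ`. -/
def liftedPolytope {d : ℕ} (P : Set (Fin d → ℝ)) (ω : (Fin d → ℝ) → ℝ) :
    Set ((Fin d → ℝ) × ℝ) :=
  convexHull ℝ ((fun a => (a, ω a)) '' (P ∩ lattice d))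

/-- The lower face of the lifted polytope with outer normal vector `(c, -1)`: the set of its points
that maximize the linear functional `(x, y) ↦ ⟨c, x⟩ - y`. Up to positive scaling, the vectors
`(c, -1)` are all the vectors with negative last coordinate. -/
def lowerFace {d : ℕ} (P : Set (Fin d → ℝ)) (ω : (Fin d → ℝ) → ℝ) (c : Fin d → ℝ) :
    Set ((Fin d → ℝ) × ℝ) :=
  {q | q ∈ liftedPolytope P ω ∧
    ∀ q' ∈ liftedPolytope P ω, c ⬝ᵥ q'.1 - q'.2 ≤ c ⬝ᵥ q.1 - q.2}

/-- `T` is regular: for some weight function, the simplices of `T` are precisely the projections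
of the lower faces of the lifted polytope. (Only the values of the weight at lattice points of
`P` matter.) -/
def IsRegular {d : ℕ} (P : Set (Fin d → ℝ))
    (T : Geometry.SimplicialComplex ℝ (Fin d → ℝ)) : Prop :=
  ∃ ω : (Fin d → ℝ) → ℝ,
    {C : Set (Fin d → ℝ) | ∃ s ∈ T.faces, C = convexHull ℝ (s : Set (Fin d → ℝ))} =
      {C : Set (Fin d → ℝ) | ∃ c : Fin d → ℝ, C = Prod.fst '' lowerFace P ω c}

/-- `T` is unimodular: every `d`-simplex of `T` has normalized volume `d! · vol = 1`. -/
def IsUnimodular {d : ℕ} (T : Geometry.SimplicialComplex ℝ (Fin d → ℝ)) : Prop :=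
  ∀ s ∈ T.faces, s.card = d + 1 →
    (d ! : ℝ≥0∞) * MeasureTheory.volume (convexHull ℝ (s : Set (Fin d → ℝ))) = 1

/-! ### The `h`-polynomial -/

/-- The number `f_{k-1}(T)` of faces of `T` with `k` vertices, where `f_{-1}(T) = 1` counts the
empty face, which is not an element of `T.faces`. -/
def faceCount {d : ℕ} (T : Geometry.SimplicialComplex ℝ (Fin d → ℝ)) (k : ℕ) : ℕ :=
  if k = 0 then 1 else {s | s ∈ T.faces ∧ s.card = k}.ncard

/-- The `h`-polynomial `∑_{k=-1}^{d} f_k(T) z^(k+1) (1 - z)^(d-k)` of a `d`-dimensional complex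
in `ℝ^d`; the summation index below is `k + 1`. -/
def hPolynomial {d : ℕ} (T : Geometry.SimplicialComplex ℝ (Fin d → ℝ)) : Polynomial ℤ :=
  ∑ k ∈ Finset.range (d + 2),
    (faceCount T k : Polynomial ℤ) * Polynomial.X ^ k * (1 - Polynomial.X) ^ (d + 1 - k)

end EhrhartTheory

end

namespace EhrhartTheory

open MeasureTheory
open scoped Matrix

/-! Let `m ≥ 1`. For a lattice point `x` of `mP`, the point `x / m` lies in the relative interior of
exactly one face `s` of the triangulation, so `x` is a unique positive combination, of total weight
`m`, of the vertices of `s`. The weights are integers: `s` lies in a `d`-simplex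
(`exists_face_card_eq_of_mem_faces`), and a lattice simplex of volume at most `1 / d!` has edge
vectors forming a basis of the lattice (`exists_int_eq_of_sum_smul_mem_lattice`). Uniqueness of `s`
comes from `face_subset_of_sum_smul_mem`.

Hence `L_P(m)` is the sum over faces `s` of the number of ways to write `m` as an ordered sum of
`|s|` positive integers (`latticePointCount_eq_sum`). The face `s` contributes `(z / (1 - z)) ^ |s|`
to the Ehrhart series, and the constant term `1` plays the role of the empty face. Multiplying by
`(1 - z) ^ (d + 1)` gives the `h`-polynomial. -/

/-! ### Unimodular lattice simplices -/

/-- The simplex spanned by the origin and the standard basis vectors has volume at least `1 / d!`: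
its `2 ^ d` coordinate reflections cover the cross-polytope. -/
theorem one_le_factorial_mul_volume_cornerSimplex (d : ℕ) :
    1 ≤ (d ! : ℝ≥0∞) * volume {x : Fin d → ℝ | (∀ i, 0 ≤ x i) ∧ ∑ i, x i ≤ 1} := by
  set S := {x : Fin d → ℝ | (∀ i, 0 ≤ x i) ∧ ∑ i, x i ≤ 1} with hS
  have hcross := MeasureTheory.volume_sum_rpow_lt_one (Fin d) (p := 1) le_rfl
  simp only [Real.rpow_one, Fintype.card_fin, div_one, Real.Gamma_nat_eq_factorial,
    one_add_one_eq_two, Real.Gamma_two, mul_one] at hcross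
  let g : (Fin d → Bool) → (Fin d → ℝ) → (Fin d → ℝ) :=
    fun ε x i => (if ε i then id else Neg.neg) (x i)
  have hg : ∀ ε, MeasurePreserving (g ε) volume volume := by
    intro ε
    refine volume_preserving_pi fun i => ?_
    by_cases h : ε i
    · simp only [h, if_true]
      exact MeasurePreserving.id _
    · simp only [h]
      exact Measure.measurePreserving_neg _
  have hmeas : MeasurableSet S := by
    have : IsClosed S := by
      rw [hS, Set.ofPred_and, Set.ofPred_forall]
      exact (isClosed_iInter fun i => isClosed_le (by fun_prop) (by fun_prop)).inter
        (isClosed_le (by fun_prop) (by fun_prop))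
    exact this.measurableSet
  have hcover : {x : Fin d → ℝ | ∑ i, |x i| < 1} ⊆ ⋃ ε, g ε ⁻¹' S := by
    intro x hx
    have key : g (fun i => decide (0 ≤ x i)) x = fun i => |x i| := by
      funext i
      by_cases h : 0 ≤ x i
      · simp [g, h, abs_of_nonneg h]
      · simp [g, h, abs_of_neg (not_le.1 h)]
    refine Set.mem_iUnion.2 ⟨fun i => decide (0 ≤ x i), ?_⟩
    rw [Set.mem_preimage, key]
    exact ⟨fun i => abs_nonneg _, le_of_lt hx⟩
  have hle : ENNReal.ofReal (2 ^ d / (d ! : ℝ)) ≤ 2 ^ d * volume S := by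
    calc ENNReal.ofReal (2 ^ d / (d ! : ℝ)) = volume {x : Fin d → ℝ | ∑ i, |x i| < 1} := hcross.symm
      _ ≤ volume (⋃ ε, g ε ⁻¹' S) := measure_mono hcover
      _ ≤ ∑ ε, volume (g ε ⁻¹' S) := measure_iUnion_fintype_le _ _
      _ = 2 ^ d * volume S := by
        simp [fun ε => (hg ε).measure_preimage hmeas.nullMeasurableSet]
  have hfac : (0 : ℝ) < d ! := by exact_mod_cast d.factorial_pos
  have h2 : (2 : ℝ≥0∞) ^ d ≤ 2 ^ d * ((d ! : ℝ≥0∞) * volume S) := by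
    calc (2 : ℝ≥0∞) ^ d = (d ! : ℝ≥0∞) * ENNReal.ofReal (2 ^ d / (d ! : ℝ)) := by
          rw [← ENNReal.ofReal_natCast, ← ENNReal.ofReal_mul hfac.le, mul_div_cancel₀ _ hfac.ne',
            ENNReal.ofReal_pow zero_le_two]
          simp
      _ ≤ (d ! : ℝ≥0∞) * (2 ^ d * volume S) := by gcongr
      _ = _ := by ring
  have h3 : (2 : ℝ≥0∞) ^ d * 1 ≤ 2 ^ d * ((d ! : ℝ≥0∞) * volume S) := by simpa using h2
  exact (ENNReal.mul_le_mul_iff_right (by simp) (by simp)).1 h3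

/-- The matrix of edge vectors at the vertex `v 0` of a lattice simplex. -/
def edgeMatrix {d : ℕ} (v : Fin (d + 1) → Fin d → ℤ) : Matrix (Fin d) (Fin d) ℤ :=
  Matrix.of fun j i => v i.succ j - v 0 j

/-- The total weight is left free so that the identity serves affine dependences (total `0`), convex
combinations (total `1`) and points of `mP` (total `m`). -/
theorem edgeMatrix_map_mulVec {d : ℕ} (v : Fin (d + 1) → Fin d → ℤ) (w : Fin (d + 1) → ℝ)
    (j : Fin d) :
    ((edgeMatrix v).map (Int.cast : ℤ → ℝ) *ᵥ fun i => w i.succ) j =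
      ∑ i, w i * (v i j : ℝ) - (∑ i, w i) * v 0 j := by
  simp only [Matrix.mulVec, dotProduct, edgeMatrix, Matrix.map_apply, Matrix.of_apply,
    Fin.sum_univ_succ (n := d), Int.cast_sub, sub_mul, Finset.sum_sub_distrib, add_mul,
    Finset.sum_mul]
  simp only [mul_comm]
  ring

/-- A lattice simplex of volume at most `1 / d!` has an invertible edge matrix. -/
theorem isUnit_det_edgeMatrix {d : ℕ} (v : Fin (d + 1) → Fin d → ℤ)
    (hind : AffineIndependent ℝ fun i j => (v i j : ℝ))
    (hvol : (d ! : ℝ≥0∞) * volume (convexHull ℝ (Set.range fun i j => (v i j : ℝ))) ≤ 1) :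
    IsUnit (edgeMatrix v).det := by
  set B := (edgeMatrix v).map (Int.cast : ℤ → ℝ) with hB
  have hdet : B.det = ((edgeMatrix v).det : ℝ) :=
    ((Int.castRingHom ℝ).map_det (edgeMatrix v)).symm
  have hne : B.det ≠ 0 := by
    intro h0
    obtain ⟨u, hu, hu0⟩ := Matrix.exists_mulVec_eq_zero_iff.2 h0
    -- A kernel vector of the edge matrix becomes an affine dependence once the weight at `v 0`
    -- makes the total zero.
    let w : Fin (d + 1) → ℝ := Fin.cons (-∑ i, u i) u
    have hw : ∑ i, w i = 0 := by simp [w, Fin.sum_univ_succ]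
    have hwv : ∑ i, w i • (fun j => (v i j : ℝ)) = 0 := by
      funext j
      have h := edgeMatrix_map_mulVec v w j
      have e : (fun i : Fin d => w i.succ) = u := by funext i; simp [w]
      rw [e, ← hB, hu0, hw] at h
      simpa [Finset.sum_apply] using h.symm
    have := affineIndependent_iff.1 hind Finset.univ w hw hwv
    exact hu (funext fun i => by simpa [w] using this i.succ (Finset.mem_univ _))
  have hsub : (fun x => x + fun j => (v 0 j : ℝ)) '' (B.toLin' ''
      {x : Fin d → ℝ | (∀ i, 0 ≤ x i) ∧ ∑ i, x i ≤ 1}) ⊆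
      convexHull ℝ (Set.range fun i j => (v i j : ℝ)) := by
    rintro _ ⟨_, ⟨x, ⟨hx0, hx1⟩, rfl⟩, rfl⟩
    let w : Fin (d + 1) → ℝ := Fin.cons (1 - ∑ i, x i) x
    have hw : ∑ i, w i = 1 := by simp [w, Fin.sum_univ_succ]
    have hw0 : ∀ i, 0 ≤ w i := by
      intro i
      refine Fin.cases ?_ (fun i => ?_) i
      · simpa [w] using hx1
      · simpa [w] using hx0 i
    have e : (B.toLin' x + fun j => (v 0 j : ℝ)) = ∑ i, w i • (fun j => (v i j : ℝ)) := by
      funext j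
      have h := edgeMatrix_map_mulVec v w j
      have e : (fun i : Fin d => w i.succ) = x := by funext i; simp [w]
      rw [e, ← hB, hw] at h
      simp [Matrix.toLin'_apply, h, Finset.sum_apply]
    change B.toLin' x + (fun j => (v 0 j : ℝ)) ∈ _
    rw [e]
    exact (convex_convexHull ℝ _).sum_mem (fun i _ => hw0 i) hw
      fun i _ => subset_convexHull ℝ _ ⟨i, rfl⟩
  -- The simplex contains an affine image of the corner simplex, whose volume is scaled by `|det
  -- B|`; the lower bound `1 / d!` for the corner is enough.
  have h1 : ENNReal.ofReal |B.det| ≤ 1 := by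
    calc ENNReal.ofReal |B.det|
        ≤ ENNReal.ofReal |B.det| *
          ((d ! : ℝ≥0∞) * volume {x : Fin d → ℝ | (∀ i, 0 ≤ x i) ∧ ∑ i, x i ≤ 1}) :=
          le_mul_of_one_le_right' (one_le_factorial_mul_volume_cornerSimplex d)
      _ = (d ! : ℝ≥0∞) * volume ((fun x => x + fun j => (v 0 j : ℝ)) '' (B.toLin' ''
            {x : Fin d → ℝ | (∀ i, 0 ≤ x i) ∧ ∑ i, x i ≤ 1})) := by
          rw [Set.image_add_right, measure_preimage_add_right, Measure.addHaar_image_linearMap,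
            LinearMap.det_toLin']
          ring
      _ ≤ (d ! : ℝ≥0∞) * volume (convexHull ℝ (Set.range fun i j => (v i j : ℝ))) := by
          gcongr
      _ ≤ 1 := hvol
  have h2 : |B.det| ≤ 1 := by simpa using h1
  rw [hdet] at h2 hne
  have h3 : |(edgeMatrix v).det| ≤ 1 := by exact_mod_cast h2
  have h4 : (edgeMatrix v).det ≠ 0 := by exact_mod_cast hne
  rw [Int.isUnit_iff_abs_eq]
  exact le_antisymm h3 (Int.one_le_abs h4)

/-- Lattice points have integral homogeneous barycentric coordinates with respect to a
unimodular lattice simplex. -/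
theorem exists_int_eq_of_sum_smul_mem_lattice {d : ℕ} {t : Finset (Fin d → ℝ)}
    (ht : (t : Set (Fin d → ℝ)) ⊆ lattice d)
    (hind : AffineIndependent ℝ ((↑) : t → Fin d → ℝ)) (hcard : t.card = d + 1)
    (hvol : (d ! : ℝ≥0∞) * volume (convexHull ℝ (t : Set (Fin d → ℝ))) ≤ 1)
    (w : (Fin d → ℝ) → ℝ) (m : ℤ) (hm : ∑ y ∈ t, w y = m)
    (hx : ∑ y ∈ t, w y • y ∈ lattice d) : ∀ y ∈ t, ∃ n : ℤ, w y = n := by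
  let e : Fin (d + 1) ≃ t := (t.equivFinOfCardEq hcard).symm
  choose v hv using fun i : Fin (d + 1) => ht (e i).2
  obtain ⟨z, hz⟩ := hx
  have hv' : (fun i j => (v i j : ℝ)) = fun i => (e i : Fin d → ℝ) := funext hv
  have hsum : ∀ {M : Type} [AddCommMonoid M] (f : (Fin d → ℝ) → M),
      ∑ i, f (e i) = ∑ y ∈ t, f y := fun f => by
    rw [← Finset.sum_coe_sort t f]
    exact e.sum_comp fun y : t => f y
  have hunit : IsUnit (edgeMatrix v).det := by
    refine isUnit_det_edgeMatrix v ?_ ?_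
    · rw [hv']
      exact hind.comp_embedding e.toEmbedding
    · have : Set.range (fun i => (e i : Fin d → ℝ)) = t := by
        rw [show (fun i => (e i : Fin d → ℝ)) = Subtype.val ∘ e from rfl,
          e.surjective.range_comp, Subtype.range_coe]
      rwa [hv', this]
  have hinv := Matrix.nonsing_inv_mul _ hunit
  set C := (edgeMatrix v)⁻¹
  have hinvR : C.map (Int.cast : ℤ → ℝ) * (edgeMatrix v).map (Int.cast : ℤ → ℝ) = 1 := by
    have := congrArg (fun M => (Int.castRingHom ℝ).mapMatrix M) hinv
    simp only [map_mul, map_one] at this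
    exact this
  let u : Fin (d + 1) → ℝ := fun i => w (e i)
  have hBu : ((edgeMatrix v).map (Int.cast : ℤ → ℝ) *ᵥ fun i => u i.succ) =
      fun j => ((z j - m * v 0 j : ℤ) : ℝ) := by
    funext j
    rw [edgeMatrix_map_mulVec]
    have h1 : ∑ i, u i = m := by rw [← hm]; exact hsum w
    have h2 : ∑ i, u i * (v i j : ℝ) = z j := by
      have := congrFun hz j
      rw [Finset.sum_apply] at this
      simp only [Pi.smul_apply, smul_eq_mul] at this
      rw [this, ← hsum fun y => w y * y j]
      refine Finset.sum_congr rfl fun i _ => ?_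
      rw [← congrFun (hv i) j]
    rw [h1, h2]
    push_cast
    ring
  have hu : ∀ i : Fin d, u i.succ = ((C *ᵥ fun j => z j - m * v 0 j) i : ℤ) := by
    intro i
    have h := congrArg (fun x => C.map (Int.cast : ℤ → ℝ) *ᵥ x) hBu
    simp only [Matrix.mulVec_mulVec, hinvR, Matrix.one_mulVec] at h
    rw [show u i.succ = (fun i : Fin d => u i.succ) i from rfl, h]
    simp [Matrix.mulVec, dotProduct]
  have hu' : ∀ i, ∃ n : ℤ, u i = n := by
    intro i
    refine Fin.cases ?_ (fun i => ⟨_, hu i⟩) i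
    have h1 : ∑ i, u i = m := by rw [← hm]; exact hsum w
    rw [Fin.sum_univ_succ, Finset.sum_congr rfl fun i _ => hu i] at h1
    -- The weight at `v 0` is the integral total minus the other, integral, weights.
    refine ⟨m - ∑ i, (C *ᵥ fun j => z j - m * v 0 j) i, ?_⟩
    rw [Int.cast_sub, Int.cast_sum]
    linarith
  intro y hy
  obtain ⟨n, hn⟩ := hu' (e.symm ⟨y, hy⟩)
  exact ⟨n, by simpa [u] using hn⟩

open Finset

/-! ### Faces of a triangulation: carriers and purity -/

theorem eq_of_sum_smul_eq {E : Type*} [AddCommGroup E] [Module ℝ E] {s : Finset E}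
    (hs : AffineIndependent ℝ ((↑) : s → E)) {w w' : E → ℝ}
    (h : ∑ y ∈ s, w y = ∑ y ∈ s, w' y) (h' : ∑ y ∈ s, w y • y = ∑ y ∈ s, w' y • y) :
    ∀ y ∈ s, w y = w' y := by
  intro y hy
  have key := affineIndependent_iff.1 hs univ (fun y => w y - w' y)
    (by rw [sum_coe_sort s fun y => w y - w' y, sum_sub_distrib, h, sub_self])
    (by rw [sum_coe_sort s fun y => (w y - w' y) • y]
        simp only [sub_smul, sum_sub_distrib, h', sub_self]) ⟨y, hy⟩ (mem_univ _)
  exact sub_eq_zero.1 key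

/-- If a relative interior point of a face `s` lies in a face `t`, then `s ⊆ t`. -/
theorem face_subset_of_sum_smul_mem {E : Type*} [AddCommGroup E] [Module ℝ E]
    {T : Geometry.SimplicialComplex ℝ E} {s t : Finset E} (hs : s ∈ T.faces) (ht : t ∈ T.faces)
    {w : E → ℝ} (hw : ∀ y ∈ s, 0 < w y) (hw1 : ∑ y ∈ s, w y = 1)
    (hx : ∑ y ∈ s, w y • y ∈ convexHull ℝ (t : Set E)) : s ⊆ t := by
  classical
  have hmem := T.inter_subset_convexHull hs ht
    ⟨Finset.mem_convexHull'.2 ⟨w, fun y hy => (hw y hy).le, hw1, rfl⟩, hx⟩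
  rw [← coe_inter, Finset.mem_convexHull'] at hmem
  obtain ⟨w', -, hw1', hx'⟩ := hmem
  -- The coordinates over `s ∩ t`, extended by zero, are also coordinates over `s`; by uniqueness
  -- every vertex outside `t` would have weight zero.
  have key := eq_of_sum_smul_eq (T.indep hs) (w := w) (w' := fun y => if y ∈ t then w' y else 0)
    (by rw [sum_ite_mem, hw1, hw1'])
    (by simp only [ite_smul, zero_smul]; rw [sum_ite_mem, hx'])
  intro y hy
  by_contra hyt
  have h := key y hy
  rw [if_neg hyt] at h
  exact ne_of_gt (hw y hy) h

/-- A finite triangulation of a full-dimensional convex set is pure. -/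
theorem exists_face_card_eq_of_mem_faces {d : ℕ} {T : Geometry.SimplicialComplex ℝ (Fin d → ℝ)}
    (hfin : T.faces.Finite) (hconv : Convex ℝ T.space) (hspan : affineSpan ℝ T.space = ⊤)
    {s : Finset (Fin d → ℝ)} (hs : s ∈ T.faces) :
    ∃ t ∈ T.faces, s ⊆ t ∧ t.card = d + 1 := by
  let U : Set (Fin d → ℝ) := ⋃ t ∈ {t ∈ T.faces | t.card = d + 1}, convexHull ℝ (t : Set _)
  have hU : IsClosed U :=
    (hfin.subset (Set.sep_subset _ _)).isClosed_biUnion fun t _ =>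
      (t.finite_toSet.isCompact_convexHull ℝ).isClosed
  -- Faces with fewer than `d + 1` vertices span proper affine subspaces, which are null, so the
  -- points avoiding all of them are dense. As the space lies in the closure of its interior, the
  -- closed set `U` contains it.
  have hae : ∀ᵐ x : Fin d → ℝ, ∀ t ∈ {t ∈ T.faces | t.card ≠ d + 1},
      x ∉ convexHull ℝ (t : Set (Fin d → ℝ)) := by
    rw [ae_ball_iff (hfin.subset (Set.sep_subset _ _)).countable]
    rintro t ⟨ht, hcard⟩
    refine measure_mono_null (t := (affineSpan ℝ (t : Set (Fin d → ℝ)) : Set (Fin d → ℝ))) ?_ ?_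
    · intro x hx
      exact convexHull_subset_affineSpan _ (by simpa using hx)
    · refine Measure.addHaar_affineSubspace _ _ fun htop => hcard ?_
      have := (T.indep ht).affineSpan_eq_top_iff_card_eq_finrank_add_one.1
        (by rw [← htop]; congr 1; exact Subtype.range_coe)
      simpa using this
  have hdense := Measure.dense_of_ae hae
  have hsubU : T.space ⊆ U := by
    have hne := hconv.interior_nonempty_iff_affineSpan_eq_top.2 hspan
    calc T.space ⊆ closure T.space := subset_closure
      _ = closure (interior T.space) :=
        (hconv.closure_interior_eq_closure_of_nonempty_interior hne).symm
      _ ⊆ closure (interior T.space ∩ {x | ∀ t ∈ {t ∈ T.faces | t.card ≠ d + 1},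
            x ∉ convexHull ℝ (t : Set (Fin d → ℝ))}) :=
        closure_minimal (hdense.open_subset_closure_inter isOpen_interior) isClosed_closure
      _ ⊆ U := by
        refine closure_minimal ?_ hU
        rintro x ⟨hx, hx'⟩
        obtain ⟨t, ht, hxt⟩ := Geometry.SimplicialComplex.mem_space_iff.1 (interior_subset hx)
        refine Set.mem_biUnion (x := t) ⟨ht, ?_⟩ hxt
        by_contra hcard
        exact hx' t ⟨ht, hcard⟩ hxt
  have hsne : s.Nonempty := Geometry.SimplicialComplex.nonempty_of_mem_faces hs
  have hpos : (0 : ℝ) < s.card := by exact_mod_cast hsne.card_pos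
  -- The barycentre of `s` has all weights positive, so a face containing it contains `s`.
  let w : (Fin d → ℝ) → ℝ := fun _ => (s.card : ℝ)⁻¹
  have hw : ∀ y ∈ s, 0 < w y := fun _ _ => inv_pos.2 hpos
  have hw1 : ∑ y ∈ s, w y = 1 := by simp [w, hpos.ne']
  have hx : ∑ y ∈ s, w y • y ∈ T.space :=
    Geometry.SimplicialComplex.convexHull_subset_space hs
      (Finset.mem_convexHull'.2 ⟨w, fun y hy => (hw y hy).le, hw1, rfl⟩)
  obtain ⟨t, ⟨ht, hcard⟩, hxt⟩ := Set.mem_iUnion₂.1 (hsubU hx)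
  exact ⟨t, ht, face_subset_of_sum_smul_mem hs ht hw hw1 hxt, hcard⟩

/-! ### Counting lattice points by positive integral weights -/

theorem natCast_smul_mem_lattice {d : ℕ} {x : Fin d → ℝ} (n : ℕ) (hx : x ∈ lattice d) :
    (n : ℝ) • x ∈ lattice d := by
  obtain ⟨z, rfl⟩ := hx
  exact ⟨fun i => n * z i, by ext i; simp⟩

theorem sum_mem_lattice {d : ℕ} {ι : Type*} (s : Finset ι) {f : ι → Fin d → ℝ}
    (hf : ∀ i ∈ s, f i ∈ lattice d) : ∑ i ∈ s, f i ∈ lattice d := by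
  classical
  induction s using Finset.induction_on with
  | empty => exact ⟨0, by ext i; simp⟩
  | insert a s ha ih =>
    rw [sum_insert ha]
    obtain ⟨z, hz⟩ := hf a (mem_insert_self _ _)
    obtain ⟨z', hz'⟩ := ih fun i hi => hf i (mem_insert_of_mem hi)
    exact ⟨z + z', by ext i; simp [← hz, ← hz']⟩

open Classical in
/-- The functions with support exactly `s`, positive integral values on `s` and sum `m`. -/
noncomputable def positiveWeights {E : Type*} (s : Finset E) (m : ℕ) : Finset (E →₀ ℕ) :=
  (finsuppAntidiag s m).filter fun l => ∀ y ∈ s, l y ≠ 0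

theorem mem_positiveWeights {E : Type*} {s : Finset E} {m : ℕ} {l : E →₀ ℕ} :
    l ∈ positiveWeights s m ↔ (∑ y ∈ s, l y = m ∧ l.support ⊆ s) ∧ ∀ y ∈ s, l y ≠ 0 := by
  classical
  simp [positiveWeights]

/-- The series `X / (1 - X) = X + X² + ⋯`. -/
def positiveSeries : PowerSeries ℤ := PowerSeries.mk fun n => if n = 0 then 0 else 1

theorem positiveSeries_mul_one_sub_X :
    positiveSeries * (1 - PowerSeries.X) = PowerSeries.X := by
  ext n
  rw [mul_sub, mul_one, map_sub]
  rcases n with _ | n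
  · simp [positiveSeries]
  · rw [PowerSeries.coeff_succ_mul_X, PowerSeries.coeff_X]
    rcases n with _ | n <;> simp [positiveSeries]

/-- Expanding the product over `s`, an exponent vector contributes `1` if all its entries on `s` are
nonzero and `0` otherwise. -/
theorem coeff_positiveSeries_pow {E : Type*} (s : Finset E) (m : ℕ) :
    PowerSeries.coeff m (positiveSeries ^ s.card) = ((positiveWeights s m).card : ℤ) := by
  classical
  rw [← prod_const, PowerSeries.coeff_prod]
  simp only [positiveSeries, PowerSeries.coeff_mk]
  rw [positiveWeights, card_filter, Nat.cast_sum]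
  refine sum_congr (by congr!) fun l _ => ?_
  by_cases h : ∀ y ∈ s, l y ≠ 0
  · rw [if_pos h, prod_eq_one fun y hy => if_neg (h y hy), Nat.cast_one]
  · rw [if_neg h]
    push Not at h
    obtain ⟨y, hy, hy0⟩ := h
    rw [Nat.cast_zero]
    exact Finset.prod_eq_zero hy (if_pos hy0)

/-- Every lattice point of the dilate `mP` is, in a unique way, a positive integral combination of
total weight `m` of the vertices of a face of a unimodular triangulation. -/
theorem latticePointCount_eq_sum {d : ℕ} {P : Set (Fin d → ℝ)} (hP : IsLatticeDPolytope P)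
    {T : Geometry.SimplicialComplex ℝ (Fin d → ℝ)} (hT : IsLatticeTriangulation P T)
    (huni : IsUnimodular T) {m : ℕ} (hm : m ≠ 0) :
    latticePointCount P m = ∑ s ∈ hT.finite_faces.toFinset, (positiveWeights s m).card := by
  have hmR : (0 : ℝ) < m := by exact_mod_cast Nat.pos_of_ne_zero hm
  have hlat : ∀ {s}, s ∈ T.faces → ∀ y ∈ s, y ∈ lattice d := fun hs y hy =>
    (hT.vertices_subset (T.down_closed hs (singleton_subset_iff.2 hy) (singleton_nonempty y))).2
  have hconv : Convex ℝ T.space := by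
    obtain ⟨S, -, -, h⟩ := hP.exists_eq_convexHull
    rw [hT.space_eq, h]
    exact convex_convexHull ℝ S
  have hspan : affineSpan ℝ T.space = ⊤ := by rw [hT.space_eq]; exact hP.affineSpan_eq_top
  let f : (Σ _ : Finset (Fin d → ℝ), (Fin d → ℝ) →₀ ℕ) → Fin d → ℝ :=
    fun p => ∑ y ∈ p.1, (p.2 y : ℝ) • y
  let I := hT.finite_faces.toFinset.sigma fun s => positiveWeights s m
  have hI : ∀ {p}, p ∈ I ↔ p.1 ∈ T.faces ∧ p.2 ∈ positiveWeights p.1 m := by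
    intro p; simp [I, Set.Finite.mem_toFinset]
  have hscale : ∀ {p}, p ∈ I → (∀ y ∈ p.1, (0 : ℝ) < (m : ℝ)⁻¹ * p.2 y) ∧
      ∑ y ∈ p.1, (m : ℝ)⁻¹ * p.2 y = 1 ∧
      ∑ y ∈ p.1, ((m : ℝ)⁻¹ * p.2 y) • y = (m : ℝ)⁻¹ • f p := by
    intro p hp
    obtain ⟨⟨h1, -⟩, h3⟩ := mem_positiveWeights.1 (hI.1 hp).2
    refine ⟨fun y hy => ?_, ?_, ?_⟩
    · have : 0 < p.2 y := Nat.pos_of_ne_zero (h3 y hy)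
      positivity
    · rw [← mul_sum, ← Nat.cast_sum, h1, inv_mul_cancel₀ hmR.ne']
    · simp only [f, smul_sum, smul_smul]
  have hconvex : ∀ {p}, p ∈ I → (m : ℝ)⁻¹ • f p ∈ convexHull ℝ (p.1 : Set (Fin d → ℝ)) := by
    intro p hp
    obtain ⟨h1, h2, h3⟩ := hscale hp
    exact Finset.mem_convexHull'.2 ⟨_, fun y hy => (h1 y hy).le, h2, h3⟩
  have hinj : Set.InjOn f I := by
    intro p hp q hq hpq
    have hp' := hscale hp
    have hq' := hscale hq
    have hpq1 : p.1 = q.1 := by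
      refine Subset.antisymm ?_ ?_
      · refine face_subset_of_sum_smul_mem (hI.1 hp).1 (hI.1 hq).1 hp'.1 hp'.2.1 ?_
        rw [hp'.2.2, hpq]
        exact hconvex hq
      · refine face_subset_of_sum_smul_mem (hI.1 hq).1 (hI.1 hp).1 hq'.1 hq'.2.1 ?_
        rw [hq'.2.2, ← hpq]
        exact hconvex hp
    obtain ⟨s, l⟩ := p
    obtain ⟨s', l'⟩ := q
    obtain rfl : s = s' := hpq1
    obtain ⟨⟨h1, h2⟩, -⟩ := mem_positiveWeights.1 (hI.1 hp).2
    obtain ⟨⟨h1', h2'⟩, -⟩ := mem_positiveWeights.1 (hI.1 hq).2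
    have key := eq_of_sum_smul_eq (T.indep (hI.1 hp).1) (w := fun y => (l y : ℝ))
      (w' := fun y => (l' y : ℝ)) (by rw [← Nat.cast_sum, ← Nat.cast_sum, h1, h1']) hpq
    congr 1
    ext y
    by_cases hy : y ∈ s
    · exact_mod_cast key y hy
    · rw [Finsupp.notMem_support_iff.1 fun h => hy (h2 h),
        Finsupp.notMem_support_iff.1 fun h => hy (h2' h)]
  have himage : ((m : ℝ) • P) ∩ lattice d = f '' I := by
    refine Set.Subset.antisymm ?_ ?_
    · rintro x ⟨hxP, hxl⟩
      rw [Set.mem_smul_set_iff_inv_smul_mem₀ hmR.ne', ← hT.space_eq,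
        Geometry.SimplicialComplex.mem_space_iff] at hxP
      obtain ⟨s, hs, hxs⟩ := hxP
      obtain ⟨t, ht, hst, hcard⟩ :=
        exists_face_card_eq_of_mem_faces hT.finite_faces hconv hspan hs
      obtain ⟨w, hw0, hw1, hwx⟩ :=
        Finset.mem_convexHull'.1 (convexHull_mono (coe_subset.2 hst) hxs)
      have hmw : ∑ y ∈ t, ((m : ℝ) * w y) = m := by rw [← mul_sum, hw1, mul_one]
      have hmx : ∑ y ∈ t, ((m : ℝ) * w y) • y = x := by
        simp only [mul_smul]
        rw [← smul_sum, hwx, smul_inv_smul₀ hmR.ne']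
      have hint := exists_int_eq_of_sum_smul_mem_lattice (hlat ht) (T.indep ht) hcard
        (huni t ht hcard).le (fun y => m * w y) m (by exact_mod_cast hmw) (by rwa [hmx])
      have hnat : ∀ y ∈ t, ∃ n : ℕ, m * w y = n := by
        intro y hy
        obtain ⟨n, hn⟩ := hint y hy
        have : (0 : ℝ) ≤ n := by rw [← hn]; exact mul_nonneg hmR.le (hw0 y hy)
        lift n to ℕ using by exact_mod_cast this
        exact ⟨n, by simpa using hn⟩
      choose! n hn using hnat
      have hsumn : ∑ y ∈ t, n y = m := by
        have : ((∑ y ∈ t, n y : ℕ) : ℝ) = m := by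
          rw [Nat.cast_sum, ← hmw]
          exact sum_congr rfl fun y hy => (hn y hy).symm
        exact_mod_cast this
      classical
      -- Discarding the vertices of weight zero leaves the face with `x / m` in its relative
      -- interior; it is nonempty because `m ≠ 0`.
      let u := t.filter fun y => n y ≠ 0
      have hu : ∑ y ∈ u, n y = m := by rw [← hsumn]; exact sum_filter_ne_zero t
      have hune : u.Nonempty := by
        rw [nonempty_iff_ne_empty]
        intro h
        rw [h, sum_empty] at hu
        exact hm hu.symm
      let l : (Fin d → ℝ) →₀ ℕ := Finsupp.onFinset u (fun y => if y ∈ u then n y else 0)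
        fun y hy => by by_contra h; exact hy (if_neg h)
      have hlu : l.support ⊆ u := Finsupp.support_onFinset_subset
      have hl : ∀ y ∈ u, l y = n y := fun y hy => by simp [l, hy]
      refine ⟨⟨u, l⟩, hI.2 ⟨T.down_closed ht (filter_subset _ _) hune, ?_⟩, ?_⟩
      · refine mem_positiveWeights.2 ⟨⟨?_, hlu⟩, fun y hy => ?_⟩
        · rw [← hu]
          exact sum_congr rfl hl
        · change l y ≠ 0
          rw [hl y hy]
          exact (mem_filter.1 hy).2
      · change ∑ y ∈ u, (l y : ℝ) • y = x
        rw [sum_congr rfl fun y hy => by rw [hl y hy], ← hmx, sum_filter]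
        refine sum_congr rfl fun y hy => ?_
        rw [hn y hy]
        by_cases h : n y = 0 <;> simp [h]
    · rintro _ ⟨p, hp, rfl⟩
      refine ⟨?_, sum_mem_lattice _ fun y hy =>
        natCast_smul_mem_lattice _ (hlat (hI.1 hp).1 y hy)⟩
      rw [Set.mem_smul_set_iff_inv_smul_mem₀ hmR.ne', ← hT.space_eq]
      exact Geometry.SimplicialComplex.convexHull_subset_space (hI.1 hp).1 (hconvex hp)
  rw [latticePointCount, himage, hinj.ncard_image, Set.ncard_coe_finset, card_sigma]

/-! ### The Ehrhart series and the `h`-polynomial -/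

theorem ehrhartSeries_eq_sum {d : ℕ} {P : Set (Fin d → ℝ)} (hP : IsLatticeDPolytope P)
    {T : Geometry.SimplicialComplex ℝ (Fin d → ℝ)} (hT : IsLatticeTriangulation P T)
    (huni : IsUnimodular T) :
    ehrhartSeries P = 1 + ∑ s ∈ hT.finite_faces.toFinset, positiveSeries ^ s.card := by
  ext m
  rw [map_add, map_sum, ehrhartSeries, PowerSeries.coeff_mk, PowerSeries.coeff_one]
  rcases eq_or_ne m 0 with rfl | hm
  · rw [if_pos rfl, if_pos rfl, sum_eq_zero, add_zero]
    intro s hs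
    have hne := Geometry.SimplicialComplex.nonempty_of_mem_faces
      (hT.finite_faces.mem_toFinset.1 hs)
    rw [PowerSeries.coeff_zero_eq_constantCoeff, map_pow]
    simp [positiveSeries, hne.card_ne_zero]
  · rw [if_neg hm, if_neg hm, zero_add, latticePointCount_eq_sum hP hT huni hm, Nat.cast_sum]
    exact sum_congr rfl fun s _ => (coeff_positiveSeries_pow s m).symm

theorem card_le_of_mem_faces {d : ℕ} {T : Geometry.SimplicialComplex ℝ (Fin d → ℝ)}
    {s : Finset (Fin d → ℝ)} (hs : s ∈ T.faces) : s.card ≤ d + 1 := by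
  have h := (T.indep hs).card_le_finrank_succ
  have h' := Submodule.finrank_le (vectorSpan ℝ (Set.range ((↑) : s → Fin d → ℝ)))
  simp only [Module.finrank_fin_fun, Fintype.card_coe] at h h'
  omega

theorem hPolynomial_eq_sum {d : ℕ} {T : Geometry.SimplicialComplex ℝ (Fin d → ℝ)}
    (hfin : T.faces.Finite) :
    hPolynomial T = (1 - Polynomial.X) ^ (d + 1) + ∑ s ∈ hfin.toFinset,
      Polynomial.X ^ s.card * (1 - Polynomial.X) ^ (d + 1 - s.card) := by
  -- Faces are grouped by dimension; the truncated subtraction is harmless since faces are nonempty.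
  have hmaps : ∀ s ∈ hfin.toFinset, s.card - 1 ∈ range (d + 1) := by
    intro s hs
    have h := card_le_of_mem_faces (hfin.mem_toFinset.1 hs)
    rw [mem_range]
    omega
  rw [hPolynomial, sum_range_succ', add_comm]
  congr 1
  · simp [faceCount]
  rw [← sum_fiberwise_of_maps_to hmaps]
  refine sum_congr rfl fun k _ => ?_
  have hset : {s | s ∈ T.faces ∧ s.card = k + 1} =
      ((hfin.toFinset.filter fun s => s.card - 1 = k : Finset _) : Set (Finset (Fin d → ℝ))) := by
    ext s
    simp only [Set.mem_ofPred_eq, coe_filter, hfin.mem_toFinset]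
    refine and_congr_right fun hs => ?_
    have := (Geometry.SimplicialComplex.nonempty_of_mem_faces hs).card_pos
    omega
  rw [faceCount, if_neg k.succ_ne_zero, hset, Set.ncard_coe_finset, mul_assoc, ← nsmul_eq_mul,
    ← sum_const]
  refine sum_congr rfl fun s hs => ?_
  have hs' := mem_filter.1 hs
  have := (Geometry.SimplicialComplex.nonempty_of_mem_faces
    (hfin.mem_toFinset.1 hs'.1)).card_pos
  rw [show s.card = k + 1 by omega]

theorem isHStarPolynomial_hPolynomial {d : ℕ} {P : Set (Fin d → ℝ)} (hP : IsLatticeDPolytope P)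
    {T : Geometry.SimplicialComplex ℝ (Fin d → ℝ)} (hT : IsLatticeTriangulation P T)
    (huni : IsUnimodular T) : IsHStarPolynomial P (hPolynomial T) := by
  rw [IsHStarPolynomial, ehrhartSeries_eq_sum hP hT huni, hPolynomial_eq_sum hT.finite_faces,
    add_mul, one_mul, sum_mul, ← Polynomial.coeToPowerSeries.ringHom_apply, map_add, map_sum]
  simp only [map_mul, map_pow, map_sub, map_one, Polynomial.coeToPowerSeries.ringHom_apply,
    Polynomial.coe_X]
  congr 1
  refine sum_congr rfl fun s hs => ?_
  -- Of the `d + 1` factors `1 - X`, exactly `|s|` are absorbed by the denominators of `(X / (1 -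
  -- X)) ^ |s|`.
  rw [← Nat.add_sub_cancel' (card_le_of_mem_faces (hT.finite_faces.mem_toFinset.1 hs)), pow_add,
    ← mul_assoc, ← mul_pow, positiveSeries_mul_one_sub_X, Nat.add_sub_cancel_left]

end EhrhartTheory

theorem mainTheorem7 {d : ℕ} (P : Set (Fin d → ℝ)) (hP : EhrhartTheory.IsLatticeDPolytope P)
    (T : Geometry.SimplicialComplex ℝ (Fin d → ℝ))
    (hT : EhrhartTheory.IsLatticeTriangulation P T)
    (hreg : EhrhartTheory.IsRegular P T) (huni : EhrhartTheory.IsUnimodular T) :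
    EhrhartTheory.IsHStarPolynomial P (EhrhartTheory.hStarPolynomial P) ∧
      EhrhartTheory.hStarPolynomial P = EhrhartTheory.hPolynomial T := by
  have h := EhrhartTheory.isHStarPolynomial_hPolynomial hP hT huni
  have hstar : EhrhartTheory.IsHStarPolynomial P (EhrhartTheory.hStarPolynomial P) := by
    have hex : ∃ p, EhrhartTheory.IsHStarPolynomial P p := ⟨_, h⟩
    rw [EhrhartTheory.hStarPolynomial, dif_pos hex]
    exact hex.choose_spec
  exact ⟨hstar, hstar.unique h⟩
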